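/- Let $A$ be a real simple Euclidean Jordan algebra of rank $3$ with unit $e$ (finite-dimensional; Euclidean means that $A$ has an inner product for which every multiplication operator $L(x)\colon y\mapsto xy$ is self-adjoint). Every $x\in A$ has a spectral decomposition $x=\lambda_1f_1+\lambda_2f_2+\lambda_3f_3$ with real $\lambda_i$ and a complete system $\{f_1,f_2,f_3\}$ of mutually orthogonal primitive idempotents (so $f_if_j=\delta_{ij}f_i$, $f_1+f_2+f_3=e$, and no $f_i$ is a sum of two nonzero idempotents); put $\operatorname{tr}(x)=\lambda_1+\lambda_2+\lambda_3$, $\det(x)=\lambda_1\lambda_2\lambda_3$ and $(x,y)=\operatorname{tr}(xy)$. Let $\{c_1,c_2,c_3\}$ be a complete system of mutually orthogonal primitive idempotents of $A$, and let $A=A_0\oplus A_{1/2}\oplus A_1$ be the Peirce decomposition with respect to $c_3$, where $A_\alpha$ is the eigenspace of $L(c_3)$ for the eigenvalue $\alpha$. Then $A_0$ is a Jordan subalgebra of rank $2$ with unit $e_0=c_1+c_2$; for $z\in A_0$ let $\det(z)$ be the determinant (the product of the two eigenvalues) with respect to the algebra $A_0$, let $\Omega_2\subset A_0$ be the set of the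 elements of $A_0$ whose eigenvalues in $A_0$ are all positive, and for $z\in\Omega_2$ let $z^{-1}$ be the inverse of $z$ in $A_0$, i.e. the element $w$ of $\mathbb{R}[z]=\operatorname{span}\{e_0,z,z^2,\dots\}$ with $zw=e_0$. If $y=z+\xi+t\,c_3$ with $z\in\Omega_2$, $\xi\in A_{1/2}$ and $t\in\mathbb{R}$, then $$\det(y)=\det(z)\,\bigl[\,t-(z^{-1}\xi,\xi)\,\bigr].$$ -/

import Mathlib

namespace EJA

section Basic

variable {A : Type*} [NonAssocCommRing A] [Module ℝ A]

/-- A finite-dimensional real (unital, commutative) Jordan algebra is Euclidean if it carries an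
inner product for which all multiplication operators `L(x)` are self-adjoint. -/
def IsEuclidean (A : Type*) [NonAssocCommRing A] [Module ℝ A] : Prop :=
  ∃ B : A →ₗ[ℝ] A →ₗ[ℝ] ℝ, (∀ x y, B x y = B y x) ∧ (∀ x, x ≠ 0 → 0 < B x x) ∧
    ∀ x u v, B (x * u) v = B u (x * v)

/-- The powers `x ^ k` in an algebra with unit `e`: `x ^ 0 = e` and `x ^ (k + 1) = x * x ^ k`. -/
def jpow (e x : A) : ℕ → A
  | 0 => e
  | k + 1 => x * jpow e x k

/-- `ℝ[x]`, the span of the powers of `x`, in an algebra with unit `e`. -/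
def polys (e x : A) : Submodule ℝ A := Submodule.span ℝ (Set.range (jpow e x))

/-- `A` has rank `r`: `r` is the largest degree of the minimal polynomial of an element `x`, the
degree of the minimal polynomial of `x` being the dimension of `ℝ[x]`. -/
def HasRank (A : Type*) [NonAssocCommRing A] [Module ℝ A] (r : ℕ) : Prop :=
  IsGreatest (Set.range fun x : A => Module.finrank ℝ (polys 1 x)) r

/-- The Peirce space `A_α` of `c`: the eigenspace of `L(c)` for the eigenvalue `α`. -/
def peirce [SMulCommClass ℝ A A] (c : A) (α : ℝ) : Submodule ℝ A :=
  Module.End.eigenspace (LinearMap.mulLeft ℝ c) α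

/-! In the rest `S` is a Jordan subalgebra of `A` which has a unit `e` (possibly different from
that of `A`), and everything is understood with respect to the algebra `S`. The case of `A` itself
is `S = ⊤`, `e = 1`. -/

/-- `c` is a primitive idempotent of `S`: a nonzero idempotent that is not the sum of two nonzero
idempotents of `S`. (Two idempotents whose sum is an idempotent are automatically orthogonal.) -/
structure IsPrimitive (S : Submodule ℝ A) (c : A) : Prop where
  mem : c ∈ S
  idem : c * c = c
  ne_zero : c ≠ 0
  eq_zero_or : ∀ a ∈ S, ∀ b ∈ S, a * a = a → b * b = b → a + b = c → a = 0 ∨ b = 0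

/-- A complete system of mutually orthogonal primitive idempotents of `S`. -/
structure IsFrame (S : Submodule ℝ A) (e : A) {r : ℕ} (c : Fin r → A) : Prop where
  primitive : ∀ i, IsPrimitive S (c i)
  orthogonal : ∀ i j, i ≠ j → c i * c j = 0
  sum_eq : ∑ i, c i = e

/-- `x = ∑ lᵢ cᵢ` is a spectral decomposition of `x` in `S`. -/
structure IsSpectral (S : Submodule ℝ A) (e x : A) {r : ℕ} (c : Fin r → A) (l : Fin r → ℝ) :
    Prop where
  frame : IsFrame S e c
  eq_sum : x = ∑ i, l i • c i

open Classical in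
/-- The trace in `S`: the sum of the eigenvalues in a spectral decomposition. -/
noncomputable def tr (S : Submodule ℝ A) (e x : A) : ℝ :=
  if h : ∃ (s : ℝ) (r : ℕ) (c : Fin r → A) (l : Fin r → ℝ),
    IsSpectral S e x c l ∧ s = ∑ i, l i then h.choose else 0

open Classical in
/-- The determinant in `S`: the product of the eigenvalues in a spectral decomposition. -/
noncomputable def det (S : Submodule ℝ A) (e x : A) : ℝ :=
  if h : ∃ (s : ℝ) (r : ℕ) (c : Fin r → A) (l : Fin r → ℝ),
    IsSpectral S e x c l ∧ s = ∏ i, l i then h.choose else 0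

/-- The cone of positivity of `S`: the elements of `S` with positive eigenvalues. -/
def cone (S : Submodule ℝ A) (e : A) : Set A :=
  {x | ∃ (r : ℕ) (c : Fin r → A) (l : Fin r → ℝ), IsSpectral S e x c l ∧ ∀ i, 0 < l i}

open Classical in
/-- The inverse of `x` in an algebra with unit `e`: the element `w` of `ℝ[x]` with `x * w = e`. -/
noncomputable def inv (e x : A) : A :=
  if h : ∃ w ∈ polys e x, x * w = e then h.choose else 0

/-- The inner product `(x, y) = tr (x y)` of `A`. -/
noncomputable def ip (x y : A) : ℝ := tr ⊤ 1 (x * y)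

end Basic

end EJA

/-!
The determinant of an element with eigenvalues `l₁, l₂, l₃` is by Newton's formula a polynomial in
the power sums `∑ lᵢ ^ k`. If `τ` is a linear form equal to `1` on all primitive idempotents, these
power sums are `τ y`, `τ (y * y)` and `τ (y * (y * y))`. So the eigenvalues of `y` need not be
computed: when `τ` is moreover associative, the Peirce rules suffice to expand the power sums of
`y = z + ξ + t c₃` (`EJA.IsTrace.newton_add`), the determinant of `z` in `A_0` being treated in the
same way. The inverse of `z` is `d⁻¹ (s e₀ - z)`, with `s` and `d` the trace and the determinant of
`z`, because `z ^ 2 - s z + d e₀ = 0` (`EJA.inv_eq`).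

The form `τ` is `B(1, ·)` for an associative inner product `B`, suitably normalized
(`EJA.exists_isTrace`). It has to be shown that all primitive idempotents have the same length.
If `p` and `q` are two of them, then the Peirce spaces `A_1(p)` and `A_1(q)` are one-dimensional,
which describes `p (p q)` and `q (q p)`; the linearized Jordan identity then gives
equal lengths unless `p q = 0` (`EJA.IsPrimitive.length_eq`). The elements annihilated by all
primitive idempotents of length different from that of `p` form an ideal, which contains `p` but not
`1` if there are such idempotents; so simplicity excludes them
(`EJA.IsPrimitive.length_eq_of_isSimpleRing`).

Both this and the fact that `τ` computes `tr` and `det` need the spectral theorem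
(`EJA.exists_isSpectral`). By power associativity, `L(x)` commutes with `L(g)` for `g ∈ ℝ[x]`.
Hence the components of `1` in the eigenspaces of the self-adjoint operator `L(x)` on `ℝ[x]` are
orthogonal idempotents, and these split further into primitive ones.
-/

namespace EJA

/-! ### Idempotents -/

section Idempotents

variable {A : Type*} [NonAssocCommRing A] [Module ℝ A]

/-- Two idempotents whose sum is idempotent are orthogonal. -/
theorem mul_eq_zero_of_add_idem {a b g : A} (ha : a * a = a) (hb : b * b = b) (hg : g * g = g)
    (h : a + b = g) : a * b = 0 := by
  subst h
  simp only [add_mul, mul_add, ha, hb, mul_comm b a] at hg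
  have : (2 : ℝ) • (a * b) = 0 := by
    rw [← sub_eq_zero] at hg
    rw [← hg]
    module
  exact (smul_eq_zero.mp this).resolve_left two_ne_zero

/-- A primitive idempotent is not the sum of two nonzero idempotents, hence the only nonzero
idempotent of its Peirce space `A_1` is itself. -/
theorem IsPrimitive.eq_zero_or_eq {p g : A} (hp : IsPrimitive (⊤ : Submodule ℝ A) p)
    (hg : g * g = g) (hpg : p * g = g) : g = 0 ∨ g = p := by
  have := hp.eq_zero_or g trivial (p - g) trivial hg
    (by simp only [mul_sub, sub_mul, hp.idem, hpg, hg, mul_comm g p]; abel) (by abel)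
  exact this.imp id fun h => (sub_eq_zero.mp h).symm

/-- A finite set of nonzero mutually orthogonal idempotents with sum `1`, in the span of which `x`
lies. -/
structure IsResolution (x : A) (s : Finset A) : Prop where
  idem : ∀ a ∈ s, a * a = a
  ne_zero : ∀ a ∈ s, a ≠ 0
  orthogonal : ∀ a ∈ s, ∀ b ∈ s, a ≠ b → a * b = 0
  sum_eq : ∑ a ∈ s, a = 1
  eq_sum : ∃ l : A → ℝ, x = ∑ a ∈ s, l a • a

variable [SMulCommClass ℝ A A]

theorem IsResolution.card_le [FiniteDimensional ℝ A] {x : A} {s : Finset A} (h : IsResolution x s) :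
    s.card ≤ Module.finrank ℝ A := by
  have hli : LinearIndependent ℝ (fun a : s => (a : A)) := by
    rw [Fintype.linearIndependent_iff]
    intro l hl b
    have e := congrArg (fun y => (b : A) * y) hl
    simp only [Finset.mul_sum, mul_smul_comm, mul_zero] at e
    rw [Finset.sum_eq_single b (fun a _ hab => by
      rw [h.orthogonal b b.2 a a.2 (fun hh => hab (Subtype.ext hh.symm)), smul_zero])
      (fun hb => absurd (Finset.mem_univ b) hb), h.idem b b.2] at e
    exact (smul_eq_zero.mp e).resolve_right (h.ne_zero b b.2)
  simpa using hli.fintype_card_le_finrank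

theorem mul_mem_polys {e x g : A} (hg : g ∈ polys e x) : x * g ∈ polys e x := by
  induction hg using Submodule.span_induction with
  | mem y hy => obtain ⟨k, rfl⟩ := hy; exact Submodule.subset_span ⟨k + 1, rfl⟩
  | zero => simp
  | add a b _ _ ha hb => rw [mul_add]; exact add_mem ha hb
  | smul r a _ ha => rw [mul_smul_comm]; exact Submodule.smul_mem _ _ ha

end Idempotents

/-! ### Jordan identities -/

section Jordan

variable {A : Type*} [NonAssocCommRing A] [Module ℝ A] [IsCommJordan A]

/-- The full linearization of the Jordan identity. -/
theorem jordan_linearized (a b c d : A) :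
    a * (b * c * d) + b * (c * a * d) + c * (a * b * d) =
      b * c * (a * d) + c * a * (b * d) + a * b * (c * d) := by
  have h := DFunLike.congr_fun (two_nsmul_lie_lmul_lmul_add_add_eq_zero a b c) d
  have h2 : (2 : ℝ) • (a * (b * c * d) - b * c * (a * d) + (b * (c * a * d) - c * a * (b * d)) +
      (c * (a * b * d) - a * b * (c * d))) = 0 := by
    rw [ofNat_smul_eq_nsmul]; exact h
  have h3 := (smul_eq_zero.mp h2).resolve_left two_ne_zero
  rw [← sub_eq_zero, ← h3]
  abel

/-- Multiplication by `a * (b * c)`, expressed through the multiplications by `a`, `b`, `c` and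
their pairwise products. -/
theorem mul_mul_mul_eq (a b c d : A) :
    a * (b * c) * d = a * (b * c * d) + b * (c * a * d) + c * (a * b * d)
      - b * (a * (c * d)) - c * (a * (b * d)) := by
  have h1 := jordan_linearized a b c d
  -- the right-hand side of `h1` is symmetric in all four variables
  have h2 := jordan_linearized d b c a
  rw [mul_comm (b * c) a, mul_comm (c * d) a, mul_comm d b, mul_comm (b * d) a, mul_comm d a,
    mul_comm b a, mul_comm (c * d), mul_comm (b * d), add_right_comm (b * c * (a * d)), ← h1,
    ← sub_eq_zero] at h2
  rw [mul_comm (a * (b * c)) d, ← sub_eq_zero, ← h2]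
  abel

/-- Jordan algebras are power associative: `L(x)` commutes with `L(x ^ k)`. -/
theorem mul_jpow_mul_comm (x : A) (k : ℕ) (d : A) :
    x * (jpow 1 x k * d) = jpow 1 x k * (x * d) := by
  have hsq (d : A) : x * (x * x * d) = x * x * (x * d) := by
    have h := IsCommJordan.lmul_comm_rmul_rmul x d
    rw [mul_comm (x * x) d, ← h, mul_comm]
  suffices h : ∀ k, (∀ d, x * (jpow 1 x k * d) = jpow 1 x k * (x * d)) ∧
      ∀ d, x * (jpow 1 x (k + 1) * d) = jpow 1 x (k + 1) * (x * d) from (h k).1 d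
  intro k
  induction k with
  | zero => exact ⟨fun d => by simp [jpow], fun d => by simp [jpow]⟩
  | succ k ih =>
    refine ⟨ih.2, fun d => ?_⟩
    have e (d : A) : jpow 1 x (k + 1 + 1) * d = x * (jpow 1 x (k + 1) * d)
        + x * (jpow 1 x (k + 1) * d) + jpow 1 x k * (x * x * d)
        - x * (x * (jpow 1 x k * d)) - jpow 1 x k * (x * (x * d)) := by
      have h := mul_mul_mul_eq x x (jpow 1 x k) d
      rw [mul_comm (jpow 1 x k) x] at h
      exact h
    rw [e, e]
    simp only [mul_add, mul_sub, ih.1, ih.2, hsq]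

/-- For an idempotent `p`, the operator `L(p)` commutes with `L(x)` whenever `x` lies in the Peirce
space `A_1(p)`. -/
theorem mul_mul_comm_of_mul_eq_self {p x : A} (hp : p * p = p) (hx : p * x = x) (d : A) :
    p * (x * d) = x * (p * d) := by
  have h := jordan_linearized p p x d
  rw [mul_comm x p, hx, hp] at h
  rw [← sub_eq_zero] at h ⊢
  rw [← h]
  abel

theorem mul_mul_comm_of_mul_eq_zero {p x : A} (hp : p * p = p) (hx : p * x = 0) (d : A) :
    p * (x * d) = x * (p * d) := by
  have h := jordan_linearized p p x d
  rw [mul_comm x p, hx, hp] at h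
  simpa using h.symm

/-- Peirce rule: `A_1(p)` is closed under multiplication. -/
theorem mul_mul_eq_of_mul_eq_self {p x y : A} (hp : p * p = p) (hx : p * x = x)
    (hy : p * y = y) : p * (x * y) = x * y := by
  rw [mul_mul_comm_of_mul_eq_self hp hx, hy]

/-- Peirce rule: `A_1(p) A_0(p) = 0`. -/
theorem mul_eq_zero_of_peirce {p x y : A} (hp : p * p = p) (hx : p * x = x)
    (hy : p * y = 0) : x * y = 0 := by
  have h1 := mul_mul_comm_of_mul_eq_self hp hx y
  have h2 := mul_mul_comm_of_mul_eq_zero hp hy x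
  rw [hx, mul_comm y x, h1, hy, mul_zero] at h2
  exact h2.symm

/-- The minimal polynomial of `L(p)` for an idempotent `p` divides `2X³ - 3X² + X`. -/
theorem two_smul_mul_mul_mul {p : A} (hp : p * p = p) (x : A) :
    (2 : ℝ) • (p * (p * (p * x))) = (3 : ℝ) • (p * (p * x)) - p * x := by
  have h := mul_mul_mul_eq x p p p
  simp only [hp, mul_comm x p, mul_comm (p * x) p] at h
  rw [← sub_eq_zero] at h ⊢
  rw [← neg_zero, ← h]
  module

/-- Splitting a member of a resolution into two nonzero idempotents gives a larger resolution. -/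
theorem IsResolution.exists_card_lt {x : A} {s : Finset A} (h : IsResolution x s) {a b : A}
    (ha : a * a = a) (hb : b * b = b) (ha0 : a ≠ 0) (hb0 : b ≠ 0) (hab : a + b ∈ s) :
    ∃ t : Finset A, IsResolution x t ∧ s.card < t.card := by
  classical
  obtain ⟨l, hl⟩ := h.eq_sum
  set g := a + b with hg
  have hab0 : a * b = 0 := mul_eq_zero_of_add_idem ha hb (h.idem g hab) hg.symm
  have hga : g * a = a := by rw [hg, add_mul, ha, mul_comm, hab0, add_zero]
  have hgb : g * b = b := by rw [hg, add_mul, hb, hab0, zero_add]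
  have horth {c d : A} (hc : g * c = c) (hd : d ∈ s.erase g) : c * d = 0 :=
    mul_eq_zero_of_peirce (h.idem g hab) hc
      (h.orthogonal g hab d (Finset.mem_of_mem_erase hd) (Finset.ne_of_mem_erase hd).symm)
  have hnot {c : A} (hc : g * c = c) (hcc : c * c = c) (hc0 : c ≠ 0) : c ∉ s.erase g :=
    fun hm => hc0 (by rw [← hcc, horth hc hm])
  have hne : a ≠ b := fun e => ha0 (by rw [← ha]; nth_rw 2 [e]; exact hab0)
  have hbn := hnot hgb hb hb0
  have han : a ∉ insert b (s.erase g) := by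
    rw [Finset.mem_insert, not_or]
    exact ⟨hne, hnot hga ha ha0⟩
  refine ⟨insert a (insert b (s.erase g)), ⟨?_, ?_, ?_, ?_, ?_⟩, ?_⟩
  · simp only [Finset.forall_mem_insert]
    exact ⟨ha, hb, fun c hc => h.idem c (Finset.mem_of_mem_erase hc)⟩
  · simp only [Finset.forall_mem_insert]
    exact ⟨ha0, hb0, fun c hc => h.ne_zero c (Finset.mem_of_mem_erase hc)⟩
  · simp only [Finset.forall_mem_insert]
    refine ⟨⟨fun e => absurd rfl e, fun _ => hab0, fun c hc _ => horth hga hc⟩,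
      ⟨fun _ => by rw [mul_comm, hab0], fun e => absurd rfl e, fun c hc _ => horth hgb hc⟩,
      fun c hc => ⟨fun _ => by rw [mul_comm, horth hga hc], fun _ => by rw [mul_comm, horth hgb hc],
        fun d hd => h.orthogonal c (Finset.mem_of_mem_erase hc) d (Finset.mem_of_mem_erase hd)⟩⟩
  · rw [Finset.sum_insert han, Finset.sum_insert hbn, ← add_assoc, ← hg,
      Finset.add_sum_erase s (fun a => a) hab, h.sum_eq]
  · refine ⟨fun c => if c ∈ s.erase g then l c else l g, ?_⟩
    rw [Finset.sum_insert han, Finset.sum_insert hbn, ← add_assoc]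
    beta_reduce
    rw [if_neg hbn, if_neg (hnot hga ha ha0), ← smul_add, ← hg, hl,
      ← Finset.add_sum_erase s (fun a => l a • a) hab]
    congr 1
    exact Finset.sum_congr rfl fun c hc => by rw [if_pos hc]
  · rw [Finset.card_insert_of_notMem han, Finset.card_insert_of_notMem hbn,
      Finset.card_erase_of_mem hab]
    have := Finset.card_pos.mpr ⟨g, hab⟩
    omega

/-- A primitive idempotent of the Peirce space `A_0(c)` is primitive in the whole algebra. -/
theorem IsPrimitive.top_of_peirce [SMulCommClass ℝ A A] {c f : A} (hf : IsPrimitive (peirce c 0) f) :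
    IsPrimitive (⊤ : Submodule ℝ A) f := by
  refine ⟨trivial, hf.idem, hf.ne_zero, fun a _ b _ ha hb hab => ?_⟩
  have hcf : f * c = 0 := by
    have := Module.End.mem_eigenspace_iff.mp hf.mem
    rw [mul_comm]
    simpa using this
  -- a summand of `f` lies in `A_1(f)`, and `c` in `A_0(f)`
  have key {a b : A} (ha : a * a = a) (hb : b * b = b) (hab : a + b = f) : a ∈ peirce c 0 := by
    have h0 := mul_eq_zero_of_add_idem ha hb hf.idem hab
    have hfa : f * a = a := by rw [← hab, add_mul, ha, mul_comm b, h0, add_zero]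
    have := mul_eq_zero_of_peirce hf.idem hfa hcf
    refine Module.End.mem_eigenspace_iff.mpr ?_
    rw [LinearMap.mulLeft_apply, mul_comm, this, zero_smul]
  exact hf.eq_zero_or a (key ha hb hab) b (key hb ha (by rw [add_comm, hab])) ha hb hab

end Jordan

section Peirce

variable {A : Type*} [NonAssocCommRing A] [Module ℝ A] [SMulCommClass ℝ A A]
  [IsScalarTower ℝ A A] [IsCommJordan A]

/-- `L(x)` commutes with `L(g)` for every `g ∈ ℝ[x]`. -/
theorem mul_mul_comm_of_mem_polys {x g : A} (hg : g ∈ polys 1 x) (d : A) :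
    x * (g * d) = g * (x * d) := by
  induction hg using Submodule.span_induction with
  | mem y hy => obtain ⟨k, rfl⟩ := hy; exact mul_jpow_mul_comm x k d
  | zero => simp
  | add a b _ _ ha hb => rw [add_mul, mul_add, ha, hb, add_mul]
  | smul r a _ ha => rw [smul_mul_assoc, mul_smul_comm, ha, smul_mul_assoc]

end Peirce

/-! ### Spectral theorem -/

/-- A self-adjoint operator on a real finite-dimensional space with a positive definite form is
diagonalizable. -/
theorem iSup_eigenspace_eq_top {V : Type*} [AddCommGroup V] [Module ℝ V] [FiniteDimensional ℝ V]
    (B : V →ₗ[ℝ] V →ₗ[ℝ] ℝ) (hsymm : ∀ x y, B x y = B y x) (hpos : ∀ x, x ≠ 0 → 0 < B x x)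
    (T : Module.End ℝ V) (hT : ∀ u v, B (T u) v = B u (T v)) :
    ⨆ μ, Module.End.eigenspace T μ = ⊤ := by
  let C : InnerProductSpace.Core ℝ V :=
    { inner := fun x y => B x y
      conj_inner_symm := fun x y => by simp [hsymm x y]
      re_inner_nonneg := fun x => by
        by_cases hx : x = 0
        · simp [hx]
        · simpa using (hpos x hx).le
      add_left := fun x y z => by simp
      smul_left := fun x y r => by simp
      definite := fun x hx => by
        by_contra h
        exact (hpos x h).ne' hx }
  let _ : NormedAddCommGroup V := C.toNormedAddCommGroup
  let _ : InnerProductSpace ℝ V := InnerProductSpace.ofCore C.toCore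
  have hS : T.IsSymmetric := fun u v => hT u v
  exact Submodule.orthogonal_eq_bot_iff.mp hS.orthogonalComplement_iSup_eigenspaces_eq_bot

section Spectral

variable {A : Type*} [NonAssocCommRing A] [Module ℝ A] [SMulCommClass ℝ A A]
  [IsScalarTower ℝ A A] [FiniteDimensional ℝ A] [IsCommJordan A]

/-- The spectral decomposition of `x` with pairwise distinct eigenvalues: the unit is a sum of
mutually orthogonal idempotents which lie in `ℝ[x]` and are eigenvectors of `L(x)`. -/
theorem exists_spectral_idempotents (hE : IsEuclidean A) (x : A) :
    ∃ (s : Finset ℝ) (g : ℝ → A), (∀ μ, g μ ∈ polys 1 x) ∧ (∀ μ, x * g μ = μ • g μ) ∧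
      (∀ μ, g μ * g μ = g μ) ∧ (∀ μ ν, μ ≠ ν → g μ * g ν = 0) ∧ ∑ μ ∈ s, g μ = 1 := by
  obtain ⟨B, hsymm, hpos, hassoc⟩ := hE
  let T : Module.End ℝ (polys 1 x) :=
    (LinearMap.mulLeft ℝ x).restrict (fun _ hg => mul_mem_polys hg)
  have htop := iSup_eigenspace_eq_top (B.domRestrict₁₂ (polys 1 x) (polys 1 x))
    (fun u v => hsymm u v) (fun u hu => hpos u (by simpa using hu)) T
    (fun u v => hassoc x u v)
  have h1 : (⟨1, Submodule.subset_span ⟨0, rfl⟩⟩ : polys 1 x) ∈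
      ⨆ μ, Module.End.eigenspace T μ := htop ▸ Submodule.mem_top
  obtain ⟨f, hf, hsum⟩ := (Submodule.mem_iSup_iff_exists_finsupp _ _).mp h1
  have hx (μ : ℝ) : x * (f μ : A) = μ • (f μ : A) :=
    congrArg Subtype.val (Module.End.mem_eigenspace_iff.mp (hf μ))
  have hsum' : ∑ μ ∈ f.support, (f μ : A) = 1 := by
    have := congrArg Subtype.val hsum
    simpa [Finsupp.sum] using this
  -- `f μ * f ν` is an eigenvector of `L(x)` both for `μ` and for `ν`
  have horth (μ ν : ℝ) (hne : μ ≠ ν) : (f μ : A) * f ν = 0 := by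
    have e1 := mul_mul_comm_of_mem_polys (f μ).2 (f ν : A)
    have e2 := mul_mul_comm_of_mem_polys (f ν).2 (f μ : A)
    rw [hx, mul_comm (f ν : A) (f μ), e1, hx, mul_smul_comm, mul_smul_comm,
      mul_comm (f ν : A) (f μ), ← sub_eq_zero, ← sub_smul] at e2
    exact (smul_eq_zero.mp e2).resolve_left (sub_ne_zero.mpr hne.symm)
  refine ⟨f.support, fun μ => f μ, fun μ => (f μ).2, hx, fun μ => ?_, horth, hsum'⟩
  have h := mul_one (f μ : A)
  have h' := congrArg (fun y => (f μ : A) * y) hsum'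
  simp only [Finset.mul_sum] at h'
  rw [h, Finset.sum_eq_single μ (fun ν _ hν => horth μ ν hν.symm)
    (fun hμ => by simp [Finsupp.notMem_support_iff.mp hμ])] at h'
  exact h'

/-- If `p` is a primitive idempotent, then `A_1(p) = ℝ p`. -/
theorem IsPrimitive.exists_eq_smul (hE : IsEuclidean A) {p x : A}
    (hp : IsPrimitive (⊤ : Submodule ℝ A) p) (hx : p * x = x) : ∃ r : ℝ, x = r • p := by
  obtain ⟨s, g, hg, hxg, hidem, -, hsum⟩ := exists_spectral_idempotents hE x
  have hpow (k : ℕ) : p * jpow 1 x (k + 1) = jpow 1 x (k + 1) := by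
    induction k with
    | zero => simpa [jpow] using hx
    | succ k ih => exact mul_mul_eq_of_mul_eq_self hp.idem hx ih
  have hpoly (y : A) (hy : y ∈ polys 1 x) : p * (x * y) = x * y := by
    induction hy using Submodule.span_induction with
    | mem y hy => obtain ⟨k, rfl⟩ := hy; exact hpow k
    | zero => simp
    | add a b _ _ ha hb => rw [mul_add, mul_add, ha, hb]
    | smul r a _ ha => rw [mul_smul_comm, mul_smul_comm, ha]
  have hspan : x ∈ Submodule.span ℝ {p} := by
    have e := mul_one x
    rw [← hsum, Finset.mul_sum] at e
    rw [← e]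
    refine Submodule.sum_mem _ fun μ _ => ?_
    rw [hxg]
    by_cases hμ : μ = 0
    · simp [hμ]
    · have h1 := hpoly _ (hg μ)
      rw [hxg, mul_smul_comm] at h1
      rcases hp.eq_zero_or_eq (hidem μ) (smul_right_injective A hμ h1) with h | h
      · simp [h]
      · rw [h]; exact Submodule.smul_mem _ _ (Submodule.mem_span_singleton_self p)
  obtain ⟨r, hr⟩ := Submodule.mem_span_singleton.mp hspan
  exact ⟨r, hr.symm⟩

theorem exists_isResolution (hE : IsEuclidean A) (x : A) : ∃ s : Finset A, IsResolution x s := by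
  classical
  obtain ⟨s, g, -, hxg, hidem, horth, hsum⟩ := exists_spectral_idempotents hE x
  let t := s.filter fun μ => g μ ≠ 0
  have hinj : Set.InjOn g t := by
    intro μ hμ ν _ h
    by_contra hne
    have := horth μ ν hne
    rw [← h, hidem] at this
    exact (Finset.mem_filter.mp hμ).2 this
  have hsum' : ∑ μ ∈ t, g μ = 1 := by rw [Finset.sum_filter_ne_zero]; exact hsum
  refine ⟨t.image g, ?_, ?_, ?_, ?_, ?_⟩
  · simp only [Finset.forall_mem_image]
    exact fun μ _ => hidem μ
  · simp only [Finset.forall_mem_image]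
    exact fun μ hμ => (Finset.mem_filter.mp hμ).2
  · simp only [Finset.forall_mem_image]
    exact fun μ _ ν _ hne => horth μ ν fun h => hne (h ▸ rfl)
  · rw [Finset.sum_image hinj, hsum']
  · refine ⟨fun a => Function.invFunOn g t a, ?_⟩
    rw [Finset.sum_image hinj]
    conv_lhs => rw [← mul_one x, ← hsum', Finset.mul_sum]
    refine Finset.sum_congr rfl fun μ hμ => ?_
    rw [hxg]
    exact congrArg (· • g μ) (hinj.leftInvOn_invFunOn hμ).symm

/-- The spectral theorem: every element has a spectral decomposition. -/
theorem exists_isSpectral (hE : IsEuclidean A) (x : A) :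
    ∃ (r : ℕ) (c : Fin r → A) (l : Fin r → ℝ), IsSpectral ⊤ 1 x c l := by
  -- a resolution of maximal size consists of primitive idempotents
  obtain ⟨s, hs, hmax⟩ : ∃ s : Finset A, IsResolution x s ∧
      ∀ t, IsResolution x t → t.card ≤ s.card := by
    let P : ℕ → Prop := fun n => ∃ s : Finset A, IsResolution x s ∧ s.card = n
    classical
    obtain ⟨s₀, hs₀⟩ := exists_isResolution hE x
    have hspec : P (Nat.findGreatest P (Module.finrank ℝ A)) :=
      Nat.findGreatest_spec hs₀.card_le ⟨s₀, hs₀, rfl⟩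
    obtain ⟨s, hs, hcard⟩ := hspec
    exact ⟨s, hs, fun t ht => hcard ▸ Nat.le_findGreatest ht.card_le ⟨t, ht, rfl⟩⟩
  obtain ⟨l, hl⟩ := hs.eq_sum
  let φ := s.equivFin.symm
  refine ⟨s.card, fun i => φ i, fun i => l (φ i), ⟨⟨fun i => ?_, fun i j hij => ?_, ?_⟩, ?_⟩⟩
  · refine ⟨trivial, hs.idem _ (φ i).2, hs.ne_zero _ (φ i).2, fun a _ b _ ha hb hab => ?_⟩
    by_contra! hne
    obtain ⟨t, ht, hlt⟩ := hs.exists_card_lt ha hb hne.1 hne.2 (hab ▸ (φ i).2)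
    exact absurd (hmax t ht) (not_le.mpr hlt)
  · exact hs.orthogonal _ (φ i).2 _ (φ j).2 fun e => hij (φ.injective (Subtype.ext e))
  · rw [← hs.sum_eq, ← Finset.sum_coe_sort s]
    exact φ.sum_comp (fun a : s => (a : A))
  · rw [hl, ← Finset.sum_coe_sort s]
    exact (φ.sum_comp (fun a : s => l a • (a : A))).symm

end Spectral

/-! ### The trace as a linear form -/

section Trace

variable {A : Type*} [NonAssocCommRing A] [Module ℝ A] [SMulCommClass ℝ A A]
  [IsScalarTower ℝ A A] [FiniteDimensional ℝ A] [IsCommJordan A]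

/-- The projection of `x` to the Peirce space `A_1(p)` of a primitive idempotent `p` is a multiple
of `p`. -/
theorem IsPrimitive.exists_peirce_one (hE : IsEuclidean A) {p : A}
    (hp : IsPrimitive (⊤ : Submodule ℝ A) p) (x : A) :
    ∃ r : ℝ, (2 : ℝ) • (p * (p * x)) - p * x = r • p := by
  apply hp.exists_eq_smul hE
  rw [mul_sub, mul_smul_comm, two_smul_mul_mul_mul hp.idem]
  module

/-- Two primitive idempotents which are not orthogonal have the same length. With `u = p q`,
`2 p u = u + r p` and `2 q u = u + m q`, two instances of the linearized Jordan identity compute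
`u ^ 2` and give `(m - r) u = 0`; and `r B(p, p) = B(p, q) = m B(q, q)`. -/
theorem IsPrimitive.length_eq (hE : IsEuclidean A) {B : A →ₗ[ℝ] A →ₗ[ℝ] ℝ}
    (hsymm : ∀ x y, B x y = B y x) (hpos : ∀ x, x ≠ 0 → 0 < B x x)
    (hassoc : ∀ x u v, B (x * u) v = B u (x * v)) {p q : A}
    (hp : IsPrimitive (⊤ : Submodule ℝ A) p) (hq : IsPrimitive (⊤ : Submodule ℝ A) q)
    (hpq : p * q ≠ 0) : B p p = B q q := by
  obtain ⟨r, hr⟩ := hp.exists_peirce_one hE q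
  obtain ⟨m, hm⟩ := hq.exists_peirce_one hE p
  have h1 := jordan_linearized p p q q
  have h2 := jordan_linearized q q p p
  rw [mul_comm q p] at hm h1 h2
  set u := p * q with hu
  have hquq : q * p = u := mul_comm q p
  rw [hp.idem, hq.idem, ← hu, mul_comm u q] at h1
  rw [hp.idem, hq.idem, hquq, mul_comm u p] at h2
  have hpu : p * u = (1 / 2 : ℝ) • (u + r • p) := by rw [← hr]; module
  have hqu : q * u = (1 / 2 : ℝ) • (u + m • q) := by rw [← hm]; module
  have hrm : r = m := by
    have h3 := h1.trans h2.symm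
    simp only [hpu, hqu, mul_smul_comm, mul_add, ← hu, hquq] at h3
    have h4 : (m - r) • u = 0 := by
      rw [← sub_eq_zero] at h3
      rw [← h3]
      module
    exact (sub_eq_zero.mp ((smul_eq_zero.mp h4).resolve_right hpq)).symm
  have e1 : r * B p p = B p q := by
    have h := congrArg (B p) hr
    have h' : B p u = B p q := by rw [hu, ← hassoc, hp.idem]
    have h'' : B p (p * u) = B p q := by rw [← hassoc, hp.idem, h']
    simp only [map_sub, map_smul, smul_eq_mul, h', h''] at h
    linarith
  have e2 : m * B q q = B p q := by
    have h := congrArg (B q) hm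
    have h' : B q u = B p q := by rw [← hquq, ← hassoc, hq.idem, hsymm]
    have h'' : B q (q * u) = B p q := by rw [← hassoc, hq.idem, h']
    simp only [map_sub, map_smul, smul_eq_mul, h', h''] at h
    linarith
  have hr0 : r ≠ 0 := by
    rintro rfl
    have h0 : B p q = 0 := by rw [← e1, zero_mul]
    have h' : B q u = 0 := by rw [← hquq, ← hassoc, hq.idem, hsymm, h0]
    have h'' : B u u = 0 := by
      nth_rw 1 [hu]
      rw [hassoc, hpu]
      simp [h']
    exact (hpos u hpq).ne' h''
  rw [← hrm] at e2
  exact mul_left_cancel₀ hr0 (e1.trans e2.symm)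

/-- In a simple algebra all primitive idempotents have the same length. -/
theorem IsPrimitive.length_eq_of_isSimpleRing [IsSimpleRing A] (hE : IsEuclidean A)
    {B : A →ₗ[ℝ] A →ₗ[ℝ] ℝ}
    (hsymm : ∀ x y, B x y = B y x) (hpos : ∀ x, x ≠ 0 → 0 < B x x)
    (hassoc : ∀ x u v, B (x * u) v = B u (x * v)) {p q : A}
    (hp : IsPrimitive (⊤ : Submodule ℝ A) p) (hq : IsPrimitive (⊤ : Submodule ℝ A) q) :
    B q q = B p p := by
  by_contra hne
  -- the elements annihilated by all primitive idempotents not as long as `p`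
  let K : Set A := {x | ∀ f, IsPrimitive (⊤ : Submodule ℝ A) f → B f f ≠ B p p → f * x = 0}
  have hmul (x y : A) (hy : y ∈ K) : x * y ∈ K := by
    intro f hf hfp
    obtain ⟨n, g, l, hg⟩ := exists_isSpectral hE x
    rw [hg.eq_sum, Finset.sum_mul, Finset.mul_sum]
    refine Finset.sum_eq_zero fun i _ => ?_
    rw [smul_mul_assoc, mul_smul_comm]
    by_cases hgi : B (g i) (g i) = B p p
    · have h0 : f * g i = 0 := by
        by_contra h
        exact hfp ((hf.length_eq hE hsymm hpos hassoc (hg.frame.primitive i) h).trans hgi)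
      rw [mul_mul_comm_of_mul_eq_zero hf.idem h0, hy f hf hfp, mul_zero, smul_zero]
    · rw [hy _ (hg.frame.primitive i) hgi, mul_zero, smul_zero]
  let I : TwoSidedIdeal A := TwoSidedIdeal.mk' K (fun f _ _ => mul_zero f)
    (fun {x y} hx hy f hf hfp => by rw [mul_add, hx f hf hfp, hy f hf hfp, add_zero])
    (fun {x} hx f hf hfp => by rw [mul_neg, hx f hf hfp, neg_zero])
    (fun {x y} hy => hmul x y hy) (fun {x y} hx => mul_comm y x ▸ hmul y x hx)
  have hmem (x : A) : x ∈ I ↔ x ∈ K := TwoSidedIdeal.mem_mk' _ _ _ _ _ _ _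
  rcases eq_bot_or_eq_top I with h | h
  · have hpI : p ∈ I := (hmem p).mpr fun f hf hfp => by
      by_contra h0
      exact hfp (hf.length_eq hE hsymm hpos hassoc hp h0)
    rw [h] at hpI
    exact hp.ne_zero hpI
  · have h1 : (1 : A) ∈ I := h ▸ trivial
    have := (hmem 1).mp h1 q hq hne
    exact hq.ne_zero (by rwa [mul_one] at this)

/-- A linear form which is associative, and equal to `1` on all primitive idempotents. -/
structure IsTrace (τ : A →ₗ[ℝ] ℝ) : Prop where
  assoc : ∀ x y z, τ (x * y * z) = τ (x * (y * z))
  primitive : ∀ p, IsPrimitive (⊤ : Submodule ℝ A) p → τ p = 1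

theorem exists_isTrace [IsSimpleRing A] (hE : IsEuclidean A) {p : A}
    (hp : IsPrimitive (⊤ : Submodule ℝ A) p) : ∃ τ : A →ₗ[ℝ] ℝ, IsTrace τ := by
  obtain ⟨B, hsymm, hpos, hassoc⟩ := id hE
  have hB (x y : A) : B 1 (x * y) = B x y := by rw [← hassoc, mul_one]
  refine ⟨(B p p)⁻¹ • B 1, fun x y z => ?_, fun q hq => ?_⟩
  · simp only [LinearMap.smul_apply, hB, mul_comm x y, hassoc]
  · rw [LinearMap.smul_apply, ← hq.idem, hB,
      ← hq.length_eq_of_isSimpleRing hE hsymm hpos hassoc hp, smul_eq_mul,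
      inv_mul_cancel₀ (hpos p hp.ne_zero).ne']

end Trace

/-! ### Spectral decompositions and the trace form -/

section Eigenvalues

variable {A : Type*} [NonAssocCommRing A] [Module ℝ A] [SMulCommClass ℝ A A]
  [IsScalarTower ℝ A A]

theorem IsFrame.sum_mul_sum {S : Submodule ℝ A} {e : A} {r : ℕ} {c : Fin r → A}
    (h : IsFrame S e c) (l m : Fin r → ℝ) :
    (∑ i, l i • c i) * ∑ i, m i • c i = ∑ i, (l i * m i) • c i := by
  rw [Finset.sum_mul]
  refine Finset.sum_congr rfl fun i _ => ?_
  rw [Finset.mul_sum, Finset.sum_eq_single i (fun j _ hj => by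
    rw [smul_mul_assoc, mul_smul_comm, h.orthogonal i j hj.symm, smul_zero, smul_zero]) (by simp),
    smul_mul_assoc, mul_smul_comm, (h.primitive i).idem, smul_smul]

/-- Frames which consist of elements of trace `1` compute power sums of eigenvalues. -/
theorem IsSpectral.trace_eq {τ : A →ₗ[ℝ] ℝ} {S : Submodule ℝ A} {e x : A} {r : ℕ}
    {c : Fin r → A} {l : Fin r → ℝ} (h : IsSpectral S e x c l) (hτ : ∀ i, τ (c i) = 1) :
    τ e = r ∧ τ x = ∑ i, l i ∧ τ (x * x) = ∑ i, l i ^ 2 ∧ τ (x * (x * x)) = ∑ i, l i ^ 3 := by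
  have hsum (m : Fin r → ℝ) : τ (∑ i, m i • c i) = ∑ i, m i := by simp [hτ]
  refine ⟨by simp [← h.frame.sum_eq, hτ], ?_, ?_, ?_⟩
  · rw [h.eq_sum, hsum]
  · rw [h.eq_sum, h.frame.sum_mul_sum, hsum]
    exact Finset.sum_congr rfl fun i _ => by ring
  · rw [h.eq_sum, h.frame.sum_mul_sum, h.frame.sum_mul_sum, hsum]
    exact Finset.sum_congr rfl fun i _ => by ring

variable [IsCommJordan A]

/-- Newton's formula for the determinant of the algebra `A_0(c)` of rank `2`. -/
theorem det_peirce_eq {τ : A →ₗ[ℝ] ℝ} (hτ : IsTrace τ) {c e z : A}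
    (h2 : τ e = 2) (hz : z ∈ cone (peirce c 0) e) :
    det (peirce c 0) e z = (τ z ^ 2 - τ (z * z)) / 2 := by
  have h : ∃ (s : ℝ) (r : ℕ) (f : Fin r → A) (l : Fin r → ℝ),
      IsSpectral (peirce c 0) e z f l ∧ s = ∏ i, l i := by
    obtain ⟨r, f, l, hl, -⟩ := hz
    exact ⟨_, r, f, l, hl, rfl⟩
  rw [det, dif_pos h]
  obtain ⟨r, f, l, hl, hs⟩ := h.choose_spec
  obtain ⟨e0, e1, e2, -⟩ := hl.trace_eq fun i =>
    hτ.primitive _ (hl.frame.primitive i).top_of_peirce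
  obtain rfl : r = 2 := by exact_mod_cast e0.symm.trans h2
  rw [hs, e1, e2]
  simp only [Fin.prod_univ_two, Fin.sum_univ_two]
  ring

variable [FiniteDimensional ℝ A]

theorem tr_eq (hE : IsEuclidean A) {τ : A →ₗ[ℝ] ℝ} (hτ : IsTrace τ) (x : A) :
    tr ⊤ 1 x = τ x := by
  have h : ∃ (s : ℝ) (r : ℕ) (c : Fin r → A) (l : Fin r → ℝ),
      IsSpectral ⊤ 1 x c l ∧ s = ∑ i, l i := by
    obtain ⟨r, c, l, hl⟩ := exists_isSpectral hE x
    exact ⟨_, r, c, l, hl, rfl⟩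
  rw [tr, dif_pos h]
  obtain ⟨r, c, l, hl, hs⟩ := h.choose_spec
  rw [hs, (hl.trace_eq fun i => hτ.primitive _ (hl.frame.primitive i)).2.1]

/-- Newton's formula for the determinant of an algebra of rank `3`. -/
theorem det_eq (hE : IsEuclidean A) {τ : A →ₗ[ℝ] ℝ} (hτ : IsTrace τ) (h3 : τ 1 = 3) (x : A) :
    det ⊤ 1 x = (τ x ^ 3 - 3 * τ x * τ (x * x) + 2 * τ (x * (x * x))) / 6 := by
  have h : ∃ (s : ℝ) (r : ℕ) (c : Fin r → A) (l : Fin r → ℝ),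
      IsSpectral ⊤ 1 x c l ∧ s = ∏ i, l i := by
    obtain ⟨r, c, l, hl⟩ := exists_isSpectral hE x
    exact ⟨_, r, c, l, hl, rfl⟩
  rw [det, dif_pos h]
  obtain ⟨r, c, l, hl, hs⟩ := h.choose_spec
  obtain ⟨e0, e1, e2, e3⟩ := hl.trace_eq fun i => hτ.primitive _ (hl.frame.primitive i)
  obtain rfl : r = 3 := by exact_mod_cast e0.symm.trans h3
  rw [hs, e1, e2, e3]
  simp only [Fin.prod_univ_three, Fin.sum_univ_three]
  ring

end Eigenvalues

/-! ### Inverses -/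

/-- If `e` is the unit of `ℝ[z]` and `z ^ 2 - s z + d e = 0` with `d ≠ 0`, then
`z⁻¹ = d⁻¹ (s e - z)`. -/
theorem inv_eq {A : Type*} [NonAssocCommRing A] [Module ℝ A] [SMulCommClass ℝ A A]
    [IsScalarTower ℝ A A] {e z : A} {s d : ℝ} (he : e * e = e) (hez : e * z = z)
    (hz : z * z = s • z - d • e) (hd : d ≠ 0) : inv e z = d⁻¹ • (s • e - z) := by
  have hze : z * e = z := by rw [mul_comm, hez]
  set w₀ := d⁻¹ • (s • e - z) with hw₀
  have hzw : z * w₀ = e := by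
    rw [hw₀, mul_smul_comm, mul_sub, mul_smul_comm, hze, hz, sub_sub_cancel, smul_smul,
      inv_mul_cancel₀ hd, one_smul]
  have hpow (k : ℕ) : ∃ a b : ℝ, jpow e z k = a • e + b • z := by
    induction k with
    | zero => exact ⟨1, 0, by simp [jpow]⟩
    | succ k ih =>
      obtain ⟨a, b, h⟩ := ih
      refine ⟨-(b * d), a + b * s, ?_⟩
      rw [jpow, h, mul_add, mul_smul_comm, mul_smul_comm, hze, hz]
      module
  have hpoly {w : A} (hw : w ∈ polys e z) : ∃ a b : ℝ, w = a • e + b • z := by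
    induction hw using Submodule.span_induction with
    | mem y hy => obtain ⟨k, rfl⟩ := hy; exact hpow k
    | zero => exact ⟨0, 0, by simp⟩
    | add x y _ _ hx hy =>
      obtain ⟨a, b, rfl⟩ := hx
      obtain ⟨a', b', rfl⟩ := hy
      exact ⟨a + a', b + b', by module⟩
    | smul r x _ hx =>
      obtain ⟨a, b, rfl⟩ := hx
      exact ⟨r * a, r * b, by module⟩
  have hmem : w₀ ∈ polys e z := by
    refine Submodule.smul_mem _ _ (sub_mem (Submodule.smul_mem _ _ ?_) ?_)
    · exact Submodule.subset_span ⟨0, rfl⟩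
    · exact Submodule.subset_span ⟨1, by simp [jpow, hze]⟩
  have hex : ∃ w ∈ polys e z, z * w = e := ⟨w₀, hmem, hzw⟩
  rw [inv, dif_pos hex]
  obtain ⟨hw, hzw'⟩ := hex.choose_spec
  set w := hex.choose
  -- `w = (w₀ z) w = w₀ (z w) = w₀`, all elements being combinations of `e` and `z`
  obtain ⟨a, b, hab⟩ := hpoly hw
  have hw₀e : w₀ * e = w₀ := by
    rw [hw₀, smul_mul_assoc, sub_mul, smul_mul_assoc, he, hze]
  have h1 : w₀ * (z * w) = w := by
    rw [hab, mul_add, mul_smul_comm, mul_smul_comm, hze, hz, mul_add, mul_smul_comm, mul_smul_comm,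
      mul_sub, mul_smul_comm, mul_smul_comm, hw₀e, mul_comm w₀ z, hzw, hw₀, smul_smul,
      mul_inv_cancel₀ hd, one_smul, sub_sub_cancel]
  rw [← h1, hzw', hw₀e]

/-- The quadratic equation satisfied by an element with a spectral decomposition of length `2`. -/
theorem IsSpectral.mul_self_eq {A : Type*} [NonAssocCommRing A] [Module ℝ A] [SMulCommClass ℝ A A]
    [IsScalarTower ℝ A A] {S : Submodule ℝ A} {e z : A} {f : Fin 2 → A} {l : Fin 2 → ℝ}
    (h : IsSpectral S e z f l) : z * z = (l 0 + l 1) • z - (l 0 * l 1) • e := by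
  rw [h.eq_sum, h.frame.sum_mul_sum, ← h.frame.sum_eq]
  simp only [Fin.sum_univ_two]
  module

/-! ### Traces with a factor in the Peirce space `A_{1/2}` -/

section Half

variable {A : Type*} [NonAssocCommRing A] [Module ℝ A] [SMulCommClass ℝ A A]
  {τ : A →ₗ[ℝ] ℝ}

/-- `A_0(c)` and `A_{1/2}(c)` are orthogonal. -/
theorem IsTrace.zero_mul_half (hτ : IsTrace τ) {c z ξ : A} (hz : c * z = 0)
    (hξ : c * ξ = (1 / 2 : ℝ) • ξ) : τ (z * ξ) = 0 := by
  have h : τ (z * (c * ξ)) = 0 := by rw [← hτ.assoc, mul_comm z c, hz, zero_mul, map_zero]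
  rw [hξ, mul_smul_comm, map_smul, smul_eq_mul] at h
  linarith

/-- `A_1(c)` and `A_{1/2}(c)` are orthogonal. -/
theorem IsTrace.one_mul_half (hτ : IsTrace τ) {c y ξ : A} (hy : c * y = y)
    (hξ : c * ξ = (1 / 2 : ℝ) • ξ) : τ (y * ξ) = 0 := by
  have h : τ (y * (c * ξ)) = τ (y * ξ) := by rw [← hτ.assoc, mul_comm y c, hy]
  rw [hξ, mul_smul_comm, map_smul, smul_eq_mul] at h
  linarith

variable [IsScalarTower ℝ A A] [IsCommJordan A]

/-- The cube of an element of `A_{1/2}(c)` is traceless: `c ξ ^ 2` lies in `A_1(c)`. -/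
theorem IsTrace.half_cube (hτ : IsTrace τ) {c ξ : A} (hc : c * c = c)
    (hξ : c * ξ = (1 / 2 : ℝ) • ξ) : τ (ξ * (ξ * ξ)) = 0 := by
  have h := jordan_linearized ξ ξ c c
  simp only [mul_comm ξ c, hξ, hc, smul_mul_assoc, mul_smul_comm, mul_comm (ξ * ξ) c] at h
  have h1 : c * (c * (ξ * ξ)) = c * (ξ * ξ) := by
    rw [← sub_eq_zero] at h ⊢
    rw [← h]
    module
  have h2 := hτ.one_mul_half h1 hξ
  rw [mul_comm c, hτ.assoc, hξ, mul_smul_comm, map_smul, smul_eq_mul, mul_comm] at h2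
  rw [mul_comm ξ]
  linarith

/-- The Newton expression of `z + ξ + t c` for `z ∈ A_0(c)` and `ξ ∈ A_{1/2}(c)`. -/
theorem IsTrace.newton_add (hτ : IsTrace τ) {c z ξ : A} (t : ℝ) (hc : c * c = c) (hc1 : τ c = 1)
    (hz : c * z = 0) (hξ : c * ξ = (1 / 2 : ℝ) • ξ)
    (hcub : 2 * τ (z * (z * z)) = 3 * τ z * τ (z * z) - τ z ^ 3) :
    let y := z + ξ + t • c
    (τ y ^ 3 - 3 * τ y * τ (y * y) + 2 * τ (y * (y * y))) / 6 =
      (τ z ^ 2 - τ (z * z)) / 2 * t - τ z * τ (ξ * ξ) / 2 + τ (z * (ξ * ξ)) := by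
  intro y
  have h1 : τ ξ = 0 := by
    have := hτ.one_mul_half hc hξ
    rw [hξ, map_smul, smul_eq_mul] at this
    linarith
  have h2 : τ (z * ξ) = 0 := hτ.zero_mul_half hz hξ
  have h3 : τ (ξ * (ξ * ξ)) = 0 := hτ.half_cube hc hξ
  have h4 : τ (z * z * ξ) = 0 :=
    hτ.zero_mul_half (by rw [mul_mul_comm_of_mul_eq_zero hc hz, hz, mul_zero]) hξ
  have h5 : τ (z * (z * ξ)) = 0 := by rw [← hτ.assoc, h4]
  have h6 : τ (ξ * (z * z)) = 0 := by rw [mul_comm, h4]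
  have h7 : τ (ξ * (z * ξ)) = τ (z * (ξ * ξ)) := by rw [mul_comm, hτ.assoc]
  have h8 : τ (c * (ξ * ξ)) = 1 / 2 * τ (ξ * ξ) := by
    rw [← hτ.assoc, hξ, smul_mul_assoc, map_smul, smul_eq_mul]
  have h9 : τ (c * (z * z)) = 0 := by rw [← hτ.assoc, hz, zero_mul, map_zero]
  have h10 : τ (c * (z * ξ)) = 0 := by rw [← hτ.assoc, hz, zero_mul, map_zero]
  have hyy : y * y = z * z + ξ * ξ + t ^ 2 • c + (2 : ℝ) • (z * ξ) + t • ξ := by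
    simp only [y, add_mul, mul_add, smul_mul_assoc, mul_smul_comm, mul_comm ξ z, mul_comm z c,
      mul_comm ξ c, hz, hξ, hc]
    module
  have e1 : τ y = τ z + t := by simp [y, h1, hc1]
  have e2 : τ (y * y) = τ (z * z) + τ (ξ * ξ) + t ^ 2 := by
    rw [hyy]; simp [h1, h2, hc1]
  have e3 : τ (y * (y * y)) =
      τ (z * (z * z)) + 3 * τ (z * (ξ * ξ)) + 3 / 2 * t * τ (ξ * ξ) + t ^ 3 := by
    rw [hyy]
    simp only [y, add_mul, mul_add, smul_mul_assoc, mul_smul_comm, mul_comm ξ c,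
      mul_comm z c, hz, hξ, hc, map_add, map_smul, smul_eq_mul, h1, h2, h3, h5, h6, h7, h8, h9,
      h10, hc1, map_zero]
    ring
  rw [e1, e2, e3]
  linear_combination hcub / 6

end Half

end EJA

theorem lemma2 {A : Type*} [NonAssocCommRing A] [Module ℝ A] [SMulCommClass ℝ A A]
    [IsScalarTower ℝ A A] [FiniteDimensional ℝ A] [IsCommJordan A] [IsSimpleRing A]
    (hE : EJA.IsEuclidean A) (hr : EJA.HasRank A 3)
    (c : Fin 3 → A) (hc : EJA.IsFrame (⊤ : Submodule ℝ A) 1 c)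
    (z ξ : A) (t : ℝ)
    (hz : z ∈ EJA.cone (EJA.peirce (c 2) 0) (c 0 + c 1))
    (hξ : ξ ∈ EJA.peirce (c 2) (1 / 2)) :
    EJA.det ⊤ 1 (z + ξ + t • c 2) =
      EJA.det (EJA.peirce (c 2) 0) (c 0 + c 1) z *
        (t - EJA.ip (EJA.inv (c 0 + c 1) z * ξ) ξ) := by
  obtain ⟨τ, hτ⟩ := EJA.exists_isTrace hE (hc.primitive 0)
  have hτc (i : Fin 3) : τ (c i) = 1 := hτ.primitive _ (hc.primitive i)
  have hc2 := (hc.primitive 2).idem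
  have hsum : c 0 + c 1 = 1 - c 2 := by
    rw [← hc.sum_eq, Fin.sum_univ_three, add_sub_cancel_right]
  have h3 : τ 1 = 3 := by
    rw [← hc.sum_eq, Fin.sum_univ_three, map_add, map_add, hτc, hτc, hτc]; norm_num
  have h2 : τ (c 0 + c 1) = 2 := by rw [map_add, hτc, hτc]; norm_num
  have hξ' : c 2 * ξ = (1 / 2 : ℝ) • ξ := Module.End.mem_eigenspace_iff.mp hξ
  rw [EJA.det_eq hE hτ h3, EJA.det_peirce_eq hτ h2 hz, EJA.ip, EJA.tr_eq hE hτ]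
  obtain ⟨r, f, l, hl, hpos⟩ := hz
  obtain ⟨e0, e1, e2, e3⟩ := hl.trace_eq fun i =>
    hτ.primitive _ (hl.frame.primitive i).top_of_peirce
  obtain rfl : r = 2 := by exact_mod_cast e0.symm.trans h2
  rw [Fin.sum_univ_two] at e1 e2 e3
  have hz0 : c 2 * z = 0 := by
    have : z ∈ EJA.peirce (c 2) 0 := by
      rw [hl.eq_sum]
      exact Submodule.sum_mem _ fun i _ => Submodule.smul_mem _ _ (hl.frame.primitive i).mem
    simpa using (Module.End.mem_eigenspace_iff.mp this : c 2 * z = (0 : ℝ) • z)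
  have hee : (c 0 + c 1) * (c 0 + c 1) = c 0 + c 1 := by
    rw [hsum, mul_sub, mul_one, sub_mul, one_mul, hc2, sub_self, sub_zero]
  have hez : (c 0 + c 1) * z = z := by rw [hsum, sub_mul, one_mul, hz0, sub_zero]
  have hd : l 0 * l 1 ≠ 0 := (mul_pos (hpos 0) (hpos 1)).ne'
  have hQ : τ ((c 0 + c 1) * (ξ * ξ)) = τ (ξ * ξ) / 2 := by
    rw [hsum, sub_mul, one_mul, map_sub, ← hτ.assoc, hξ', smul_mul_assoc, map_smul, smul_eq_mul]
    ring
  rw [hτ.newton_add t hc2 (hτc 2) hz0 hξ' (by rw [e1, e2, e3]; ring),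
    EJA.inv_eq hee hez hl.mul_self_eq hd, hτ.assoc, smul_mul_assoc, map_smul, sub_mul,
    smul_mul_assoc, map_sub, map_smul, hQ, e1, e2, smul_eq_mul, smul_eq_mul]
  have hl0 := (hpos 0).ne'
  have hl1 := (hpos 1).ne'
  field_simp
  ring
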